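/- **Lemma 3.12.** Let $a<b$, $c<d$, $0<\gamma<1$ and $u\in C^6([a,b]\times[c,d])$. For integers $M_x,M_y\ge 1$ put $h_x=(b-a)/M_x$, $h_y=(d-c)/M_y$, $x_{k/2}=a+\tfrac{k}{2}h_x$, $y_{k/2}=c+\tfrac{k}{2}h_y$. For $x\in[a,b]$ let $\phi_{l}$ ($0\le l\le M_x$) and $\phi_{l-1/2}$ ($1\le l\le M_x$) be the piecewise quadratic basis functions $$\phi_l(x)=\begin{cases}\frac{x-x_{l-1}}{h_x}\cdot\frac{2x-(x_l+x_{l-1})}{h_x}, & x\in[x_{l-1},x_l],\\[2pt] \frac{x_{l+1}-x}{h_x}\cdot\frac{(x_{l+1}+x_l)-2x}{h_x}, & x\in[x_l,x_{l+1}],\\ 0,&\text{otherwise,}\end{cases}\qquad \phi_{l-\frac12}(x)=\begin{cases}\frac{4(x-x_{l-1})(x_l-x)}{h_x^2}, & x\in[x_{l-1},x_l],\\ 0,&\text{otherwise}\end{cases}$$ (for $l=0$ and $l=M_x$ only the piece lying in $[a,b]$ counts), and define the basis functions $\tilde\phi_{r/2}(y)$, $0\le r\le 2M_y$, on $[c,d]$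 in the same way. Let $$u_Q(x,y)=\sum_{l=0}^{2M_x}\sum_{r=0}^{2M_y}\phi_{\frac l2}(x)\,\tilde\phi_{\frac r2}(y)\,u\big(x_{\frac l2},y_{\frac r2}\big)$$ be the piecewise biquadratic Lagrange interpolant of $u$. Then there is a constant $C$, depending only on $a,b,c,d,\gamma,u$, such that for all $M_x,M_y\ge1$ and all $1\le i\le 2M_x-1$, $1\le j\le 2M_y-1$ the integrand below is integrable on $[a,b]\times[c,d]$ and $$\left|\int_c^d\!\int_a^b \frac{u(x,y)-u_Q(x,y)}{\left|\sqrt{(x_{\frac i2}-x)^2+(y_{\frac j2}-y)^2}\right|^{\gamma}}\,dx\,dy\right|\le C\Big(h_x^4\,\eta_{\frac i2}^{-\gamma}+h_y^4\,\tilde\eta_{\frac j2}^{-\gamma}\Big)+C\big(h_x^{5-\gamma}+h_y^{5-\gamma}\big),$$ where $\eta_{i/2}=\min\{x_{i/2}-a,\;b-x_{i/2}\}$ and $\tilde\eta_{j/2}=\min\{y_{j/2}-c,\;d-y_{j/2}\}$. -/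

import Mathlib

/-- The uniform step size `h = (b - a) / M`. -/
noncomputable def meshSize (a b : ℝ) (M : ℕ) : ℝ := (b - a) / M

/-- The mesh point `x_{k/2} = a + (k/2) h`. The points of the partition of `[a, b]` are those with
`0 ≤ k ≤ 2 M`; other values of `k` only name the end points of the outer halves of the supports of
the first and the last basis function, which lie outside `[a, b]`. -/
noncomputable def halfNode (a b : ℝ) (M : ℕ) (k : ℤ) : ℝ := a + (k : ℝ) / 2 * meshSize a b M

/-- The piecewise quadratic basis function `φ_{k/2}`. For even `k = 2 l` it is the function `φ_l`
attached to the cell end point `x_l`, with pieces `φ_l^-` on `[x_{l-1}, x_l]` and `φ_l^+` on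
`[x_l, x_{l+1}]`; for odd `k = 2 l - 1` it is the bubble `φ_{l-1/2}` on `[x_{l-1}, x_l]`.
On `[a, b]`, `φ_0` reduces to its right piece and `φ_M` to its left piece. -/
noncomputable def quadBasis (a b : ℝ) (M : ℕ) (k : ℤ) (x : ℝ) : ℝ :=
  if Even k then
    if x ∈ Set.Icc (halfNode a b M (k - 2)) (halfNode a b M k) then
      (x - halfNode a b M (k - 2)) / meshSize a b M *
        ((2 * x - (halfNode a b M k + halfNode a b M (k - 2))) / meshSize a b M)
    else if x ∈ Set.Icc (halfNode a b M k) (halfNode a b M (k + 2)) then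
      (halfNode a b M (k + 2) - x) / meshSize a b M *
        (((halfNode a b M (k + 2) + halfNode a b M k) - 2 * x) / meshSize a b M)
    else 0
  else
    if x ∈ Set.Icc (halfNode a b M (k - 1)) (halfNode a b M (k + 1)) then
      4 * (x - halfNode a b M (k - 1)) * (halfNode a b M (k + 1) - x) / meshSize a b M ^ 2
    else 0

/-- The piecewise (bi)quadratic Lagrange interpolant `u_Q` of `u` on `[a, b] × [c, d]`. -/
noncomputable def quadInterp (a b c d : ℝ) (Mx My : ℕ) (u : ℝ × ℝ → ℝ) (x y : ℝ) : ℝ :=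
  ∑ l ∈ Finset.range (2 * Mx + 1), quadBasis a b Mx l x *
    ∑ r ∈ Finset.range (2 * My + 1), quadBasis c d My r y *
      u (halfNode a b Mx l, halfNode c d My r)

/-- The distance `η_{k/2} = min {x_{k/2} - a, b - x_{k/2}}` of a mesh point to the end points. -/
noncomputable def endDist (a b : ℝ) (M : ℕ) (k : ℤ) : ℝ :=
  min (halfNode a b M k - a) (b - halfNode a b M k)

/-- The interpolation error weighted with the additive kernel centred at `(x_{i/2}, y_{j/2})`. -/
noncomputable def additiveErrorIntegrand (a b c d γ : ℝ) (Mx My : ℕ) (u : ℝ × ℝ → ℝ) (i j : ℤ)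
    (x y : ℝ) : ℝ :=
  (u (x, y) - quadInterp a b c d Mx My u x y) /
    |Real.sqrt ((halfNode a b Mx i - x) ^ 2 + (halfNode c d My j - y) ^ 2)| ^ γ

open MeasureTheory Set

/-! Write `u - u_Q = (u - I_x u) + I_x (u - I_y u)` with the one-dimensional interpolation operators
`I_x`, `I_y`; each part reduces to one-variable integrals along lines. On a cell of width `h` the
quadratic interpolation error is a multiple of the nodal cubic plus `O(h^4)`, and that cubic has
mean zero. Against a monotone weight it therefore contributes only `O(h^4)` times the increment of
the weight over the cell. The increments telescope, so `abs_integral_monotoneOn_mul_interpError_le`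
gains a full order, `O(h^4)` instead of `O(h^3)`, with a constant governed by the sup of the weight.
On a line at distance `|A| > 0` from its centre the kernel is unimodal with maximum `|A|^(-γ)`,
hence a combination of monotone weights (`abs_integral_lineKernel_mul_interpError_le`). As `γ < 1`,
this bound is integrable across the lines, and the double integral is `O(h_x^4 + h_y^4)`. The
factors `η^(-γ)` are bounded below, so the claim follows. -/

/-! ### Mesh points and quadratic basis functions. -/

theorem meshSize_pos {a b : ℝ} (hab : a < b) {M : ℕ} (hM : 1 ≤ M) : 0 < meshSize a b M := by
  have : (0 : ℝ) < M := by exact_mod_cast hM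
  exact div_pos (sub_pos.2 hab) this

theorem natCast_mul_meshSize {a b : ℝ} {M : ℕ} (hM : 1 ≤ M) : M * meshSize a b M = b - a := by
  have : (M : ℝ) ≠ 0 := by positivity
  rw [meshSize]; field_simp

theorem halfNode_mem_Icc {a b : ℝ} (hab : a < b) {M : ℕ} (hM : 1 ≤ M) {k : ℕ} (hk : k ≤ 2 * M) :
    halfNode a b M k ∈ Icc a b := by
  have h := meshSize_pos hab hM
  have hM' := natCast_mul_meshSize (a := a) (b := b) hM
  have hk' : (k : ℝ) ≤ 2 * M := by exact_mod_cast hk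
  have hk0 : (0 : ℝ) ≤ k := by positivity
  simp only [halfNode, Int.cast_natCast]
  constructor <;> nlinarith

/-- Closed form of the nodal basis functions. -/
theorem quadBasis_of_even {a b : ℝ} {M : ℕ} (h : 0 < meshSize a b M) {k : ℤ} (hk : Even k)
    (x : ℝ) : quadBasis a b M k x =
      max 0 (1 - |(x - a) / meshSize a b M - k / 2|) *
        (1 - 2 * |(x - a) / meshSize a b M - k / 2|) := by
  obtain ⟨s, rfl⟩ : ∃ s, x = a + s * meshSize a b M := ⟨(x - a) / meshSize a b M, by field_simp; ring⟩
  have e : (a + s * meshSize a b M - a) / meshSize a b M = s := by field_simp; ring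
  rw [e, quadBasis, if_pos hk]
  simp only [halfNode, mem_Icc]
  push_cast
  generalize meshSize a b M = H at *
  have i1 : ∀ r s : ℝ, (a + r * H ≤ a + s * H) ↔ r ≤ s := fun r s => by
    rw [add_le_add_iff_left, mul_le_mul_iff_left₀ h]
  simp only [i1]
  split_ifs with h1 h2
  · rw [abs_of_nonpos (by linarith), max_eq_right (by linarith)]; field_simp; ring
  · rw [abs_of_nonneg (by linarith), max_eq_right (by linarith)]; field_simp; ring
  · rw [max_eq_left, zero_mul]
    by_contra! hc
    obtain ⟨h3, h4⟩ := abs_lt.1 (by linarith : |s - (k : ℝ) / 2| < 1)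
    rcases le_total s ((k : ℝ) / 2) with h5 | h5
    · exact h1 ⟨by linarith, h5⟩
    · exact h2 ⟨h5, by linarith⟩

/-- Closed form of the bubble basis functions. -/
theorem quadBasis_of_odd {a b : ℝ} {M : ℕ} (h : 0 < meshSize a b M) {k : ℤ} (hk : ¬ Even k)
    (x : ℝ) : quadBasis a b M k x =
      max 0 (1 - 4 * ((x - a) / meshSize a b M - k / 2) ^ 2) := by
  obtain ⟨s, rfl⟩ : ∃ s, x = a + s * meshSize a b M := ⟨(x - a) / meshSize a b M, by field_simp; ring⟩
  have e : (a + s * meshSize a b M - a) / meshSize a b M = s := by field_simp; ring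
  rw [e, quadBasis, if_neg hk]
  simp only [halfNode, mem_Icc]
  push_cast
  generalize meshSize a b M = H at *
  have i1 : ∀ r s : ℝ, (a + r * H ≤ a + s * H) ↔ r ≤ s := fun r s => by
    rw [add_le_add_iff_left, mul_le_mul_iff_left₀ h]
  simp only [i1]
  split_ifs with h1
  · rw [max_eq_right (by nlinarith)]; field_simp; ring
  · rw [max_eq_left]
    by_contra! hc
    obtain ⟨h3, h4⟩ := abs_lt.1 (abs_lt_of_sq_lt_sq (by nlinarith : (s - (k : ℝ) / 2) ^ 2 < (1 / 2) ^ 2)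
      (by norm_num))
    exact h1 ⟨by linarith, by linarith⟩

theorem continuous_quadBasis {a b : ℝ} {M : ℕ} (h : 0 < meshSize a b M) (k : ℤ) :
    Continuous (quadBasis a b M k) := by
  by_cases hk : Even k
  · rw [funext (quadBasis_of_even h hk)]; fun_prop
  · rw [funext (quadBasis_of_odd h hk)]; fun_prop

/-- On one cell only three basis functions are active. -/
theorem sum_quadBasis_mul {a b : ℝ} {M n : ℕ} (h : 0 < meshSize a b M) (hn : n < M) {t : ℝ}
    (ht : t ∈ Icc (0 : ℝ) 1) (G : ℕ → ℝ) :
    ∑ l ∈ Finset.range (2 * M + 1), quadBasis a b M l (a + (n + t) * meshSize a b M) * G l =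
      (1 - t) * (1 - 2 * t) * G (2 * n) + 4 * t * (1 - t) * G (2 * n + 1) +
        t * (2 * t - 1) * G (2 * n + 2) := by
  obtain ⟨ht0, ht1⟩ := ht
  have e : (a + (n + t) * meshSize a b M - a) / meshSize a b M = n + t := by field_simp; ring
  have hsub : ({2 * n, 2 * n + 1, 2 * n + 2} : Finset ℕ) ⊆ Finset.range (2 * M + 1) := by
    intro l hl
    simp only [Finset.mem_insert, Finset.mem_singleton] at hl
    simp only [Finset.mem_range]
    omega
  rw [← Finset.sum_subset hsub]
  · rw [Finset.sum_insert (by simp), Finset.sum_insert (by simp), Finset.sum_singleton,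
      quadBasis_of_even h ⟨(n : ℤ), by push_cast; ring⟩,
      quadBasis_of_odd h (k := ((2 * n + 1 : ℕ) : ℤ)) (by push_cast; simp [parity_simps]),
      quadBasis_of_even h (k := ((2 * n + 2 : ℕ) : ℤ)) ⟨(n : ℤ) + 1, by push_cast; ring⟩, e]
    push_cast
    have e1 : (n : ℝ) + t - 2 * n / 2 = t := by ring
    have e2 : (n : ℝ) + t - (2 * n + 1) / 2 = t - 1 / 2 := by ring
    have e3 : (n : ℝ) + t - (2 * n + 2) / 2 = t - 1 := by ring
    rw [e1, e2, e3, abs_of_nonneg ht0, abs_of_nonpos (by linarith : t - 1 ≤ 0),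
      max_eq_right (by linarith), max_eq_right (by nlinarith), max_eq_right (by linarith)]
    ring
  · intro l _ hl
    simp only [Finset.mem_insert, Finset.mem_singleton, not_or] at hl
    rw [mul_eq_zero]; left
    by_cases hk : Even (l : ℤ)
    · rw [quadBasis_of_even h hk, e, max_eq_left, zero_mul]
      obtain ⟨m, hm⟩ : ∃ m : ℕ, l = m + m := by exact_mod_cast hk
      subst hm
      push_cast
      have : ((m : ℝ) + m) / 2 = m := by ring
      rw [this]
      rcases lt_or_ge m n with h1 | h1
      · have : (m : ℝ) + 1 ≤ n := by exact_mod_cast h1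
        rw [abs_of_nonneg (by linarith)]; linarith
      · have : n + 2 ≤ m := by omega
        have : (n : ℝ) + 2 ≤ m := by exact_mod_cast this
        rw [abs_of_nonpos (by linarith)]; linarith
    · rw [quadBasis_of_odd h hk, e, max_eq_left]
      rw [Int.not_even_iff_odd] at hk
      obtain ⟨m, hm⟩ : ∃ m : ℕ, l = 2 * m + 1 := by exact_mod_cast hk
      subst hm
      push_cast
      rcases lt_or_ge m n with h1 | h1
      · have : (m : ℝ) + 1 ≤ n := by exact_mod_cast h1
        nlinarith
      · have : n + 1 ≤ m := by omega
        have : (n : ℝ) + 1 ≤ m := by exact_mod_cast this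
        nlinarith

/-- Every point of `[a, b]` lies in a cell. -/
theorem exists_cell_of_mem_Icc {a b : ℝ} (hab : a < b) {M : ℕ} (hM : 1 ≤ M) {x : ℝ}
    (hx : x ∈ Icc a b) :
    ∃ n < M, ∃ t ∈ Icc (0 : ℝ) 1, x = a + (n + t) * meshSize a b M := by
  have h := meshSize_pos hab hM
  have hM' := natCast_mul_meshSize (a := a) (b := b) hM
  obtain ⟨s, rfl⟩ : ∃ s, x = a + s * meshSize a b M := ⟨(x - a) / meshSize a b M, by field_simp; ring⟩
  obtain ⟨h1, h2⟩ := hx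
  have s0 : 0 ≤ s := by
    by_contra! hc
    nlinarith
  have s1 : s ≤ M := by
    by_contra! hc
    nlinarith
  rcases eq_or_lt_of_le s1 with rfl | s1
  -- At `x = b` the floor would name the nonexistent cell `M`; the last cell with `t = 1` is used
  -- instead.
  · refine ⟨M - 1, by omega, 1, by simp, ?_⟩
    push_cast [Nat.cast_sub hM]
    ring
  · exact ⟨⌊s⌋₊, (Nat.floor_lt s0).2 s1, s - ⌊s⌋₊,
      ⟨by linarith [Nat.floor_le s0], by linarith [Nat.lt_floor_add_one s]⟩, by ring⟩

/-- Each of the three shape functions has modulus at most `1` on the reference cell, so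
interpolation has sup norm at most `3`, uniformly in the mesh. -/
theorem abs_three_point_le {t A B D W : ℝ} (ht : t ∈ Icc (0 : ℝ) 1) (hA : |A| ≤ W) (hB : |B| ≤ W)
    (hD : |D| ≤ W) :
    |(1 - t) * (1 - 2 * t) * A + 4 * t * (1 - t) * B + t * (2 * t - 1) * D| ≤ 3 * W := by
  obtain ⟨h0, h1⟩ := ht
  have k1 : |(1 - t) * (1 - 2 * t)| ≤ 1 := by rw [abs_le]; constructor <;> nlinarith [sq_nonneg (t - 1)]
  have k2 : |4 * t * (1 - t)| ≤ 1 := by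
    rw [abs_le]; constructor <;> nlinarith [sq_nonneg (2 * t - 1)]
  have k3 : |t * (2 * t - 1)| ≤ 1 := by rw [abs_le]; constructor <;> nlinarith
  have l : ∀ p q : ℝ, |p| ≤ 1 → |q| ≤ W → |p * q| ≤ W := fun p q hp hq => by
    rw [abs_mul]; nlinarith [abs_nonneg p, abs_nonneg q]
  have := abs_add_three ((1 - t) * (1 - 2 * t) * A) (4 * t * (1 - t) * B) (t * (2 * t - 1) * D)
  linarith [l _ _ k1 hA, l _ _ k2 hB, l _ _ k3 hD]

theorem abs_sum_quadBasis_mul_le {a b : ℝ} (hab : a < b) {M : ℕ} (hM : 1 ≤ M) {x : ℝ}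
    (hx : x ∈ Icc a b) {G : ℕ → ℝ} {W : ℝ} (hG : ∀ l ≤ 2 * M, |G l| ≤ W) :
    |∑ l ∈ Finset.range (2 * M + 1), quadBasis a b M l x * G l| ≤ 3 * W := by
  obtain ⟨n, hn, t, ht, rfl⟩ := exists_cell_of_mem_Icc hab hM hx
  rw [sum_quadBasis_mul (meshSize_pos hab hM) hn ht]
  exact abs_three_point_le ht (hG _ (by omega)) (hG _ (by omega)) (hG _ (by omega))

/-! ### Interpolation error on one cell. -/

/-- The piecewise quadratic Lagrange interpolant of a function of one variable. -/
noncomputable def lineInterp (a b : ℝ) (M : ℕ) (f : ℝ → ℝ) (x : ℝ) : ℝ :=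
  ∑ l ∈ Finset.range (2 * M + 1), quadBasis a b M l x * f (halfNode a b M l)

theorem continuous_lineInterp {a b : ℝ} {M : ℕ} (h : 0 < meshSize a b M) (f : ℝ → ℝ) :
    Continuous (lineInterp a b M f) :=
  continuous_finsetSum _ fun _ _ => (continuous_quadBasis h _).mul continuous_const

/-- `f` has four derivatives on `[a, b]`, the third and the fourth of them bounded by `K`. -/
def HasFourDerivsBound (f : ℝ → ℝ) (a b K : ℝ) : Prop :=
  ∃ f₁ f₂ f₃ f₄ : ℝ → ℝ, ∀ x ∈ Icc a b,
    HasDerivWithinAt f (f₁ x) (Icc a b) x ∧ HasDerivWithinAt f₁ (f₂ x) (Icc a b) x ∧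
    HasDerivWithinAt f₂ (f₃ x) (Icc a b) x ∧ HasDerivWithinAt f₃ (f₄ x) (Icc a b) x ∧
    |f₃ x| ≤ K ∧ |f₄ x| ≤ K

theorem HasFourDerivsBound.mono {f : ℝ → ℝ} {a b K p q : ℝ} (hf : HasFourDerivsBound f a b K)
    (hs : Icc p q ⊆ Icc a b) : HasFourDerivsBound f p q K := by
  obtain ⟨f₁, f₂, f₃, f₄, H⟩ := hf
  refine ⟨f₁, f₂, f₃, f₄, fun x hx => ?_⟩
  obtain ⟨h1, h2, h3, h4, h5, h6⟩ := H x (hs hx)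
  exact ⟨h1.mono hs, h2.mono hs, h3.mono hs, h4.mono hs, h5, h6⟩

theorem HasFourDerivsBound.continuousOn {f : ℝ → ℝ} {a b K : ℝ} (hf : HasFourDerivsBound f a b K) :
    ContinuousOn f (Icc a b) := by
  obtain ⟨f₁, f₂, f₃, f₄, H⟩ := hf
  exact fun x hx => (H x hx).1.continuousWithinAt

/-- The mean value inequality on `[p, x]`, where the derivative bound is largest at the right end.
Iteration gives Taylor remainders, at the cost of the factorials. -/
theorem abs_le_pow_succ_of_hasDerivWithinAt {p q K : ℝ} {g g' : ℝ → ℝ} (n : ℕ) (hK : 0 ≤ K)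
    (hg : ∀ x ∈ Icc p q, HasDerivWithinAt g (g' x) (Icc p q) x) (hp : g p = 0)
    (hb : ∀ x ∈ Icc p q, |g' x| ≤ K * (x - p) ^ n) :
    ∀ x ∈ Icc p q, |g x| ≤ K * (x - p) ^ (n + 1) := by
  intro x hx
  have hs : Icc p x ⊆ Icc p q := Icc_subset_Icc_right hx.2
  have := (convex_Icc p x).norm_image_sub_le_of_norm_hasDerivWithin_le (f := g) (f' := g')
    (C := K * (x - p) ^ n) (fun y hy => (hg y (hs hy)).mono hs)
    (fun y hy => (hb y (hs hy)).trans (by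
      have := hy.1
      have := hy.2
      gcongr)) (left_mem_Icc.2 hx.1) (right_mem_Icc.2 hx.1)
  rw [hp, sub_zero, Real.norm_eq_abs, Real.norm_eq_abs, abs_of_nonneg (sub_nonneg.2 hx.1)] at this
  rw [pow_succ, ← mul_assoc]
  exact this

theorem abs_sub_taylor_le {p q K : ℝ} {f f₁ f₂ f₃ f₄ : ℝ → ℝ}
    (H : ∀ x ∈ Icc p q,
      HasDerivWithinAt f (f₁ x) (Icc p q) x ∧ HasDerivWithinAt f₁ (f₂ x) (Icc p q) x ∧
      HasDerivWithinAt f₂ (f₃ x) (Icc p q) x ∧ HasDerivWithinAt f₃ (f₄ x) (Icc p q) x ∧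
      |f₃ x| ≤ K ∧ |f₄ x| ≤ K) :
    ∀ x ∈ Icc p q, |f x - (f p + f₁ p * (x - p) + f₂ p / 2 * (x - p) ^ 2 +
      f₃ p / 6 * (x - p) ^ 3)| ≤ K * (x - p) ^ 4 := by
  intro x hx
  have hK : 0 ≤ K := (abs_nonneg _).trans (H x hx).2.2.2.2.1
  have hid : ∀ y, HasDerivWithinAt (fun z : ℝ => z - p) 1 (Icc p q) y := fun y =>
    (hasDerivWithinAt_id y _).sub_const p
  refine abs_le_pow_succ_of_hasDerivWithinAt 3 hK (g := fun x => f x - (f p + f₁ p * (x - p) +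
    f₂ p / 2 * (x - p) ^ 2 + f₃ p / 6 * (x - p) ^ 3))
    (g' := fun x => f₁ x - (f₁ p + f₂ p * (x - p) + f₃ p / 2 * (x - p) ^ 2)) ?_ (by simp) ?_ x hx
  · intro y hy
    refine ((H y hy).1.sub (((((hid y).const_mul (f₁ p)).const_add (f p)).add
      (((hid y).pow 2).const_mul (f₂ p / 2))).add
      (((hid y).pow 3).const_mul (f₃ p / 6)))).congr_deriv ?_
    norm_num
    ring
  refine abs_le_pow_succ_of_hasDerivWithinAt 2 hK
    (g' := fun x => f₂ x - (f₂ p + f₃ p * (x - p))) ?_ (by simp) ?_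
  · intro y hy
    refine ((H y hy).2.1.sub ((((hid y).const_mul (f₂ p)).const_add (f₁ p)).add
      (((hid y).pow 2).const_mul (f₃ p / 2)))).congr_deriv ?_
    norm_num
    ring
  refine abs_le_pow_succ_of_hasDerivWithinAt 1 hK (g' := fun x => f₃ x - f₃ p) ?_ (by simp) ?_
  · intro y hy
    refine ((H y hy).2.2.1.sub (((hid y).const_mul (f₃ p)).const_add (f₂ p))).congr_deriv ?_
    ring
  refine abs_le_pow_succ_of_hasDerivWithinAt 0 hK (g' := f₄) ?_ (by simp) ?_
  · intro y hy
    exact (H y hy).2.2.2.1.sub_const _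
  · intro y hy
    simpa using (H y hy).2.2.2.2.2

/-- The error of quadratic interpolation on one cell is, up to fourth order, a multiple of the
cubic with zeros at the three nodes. -/
theorem exists_abs_interpError_sub_le {p h K : ℝ} {f : ℝ → ℝ} (hh : 0 < h)
    (hf : HasFourDerivsBound f p (p + h) K) :
    ∃ κ, |κ| ≤ K ∧ ∀ t ∈ Icc (0 : ℝ) 1,
      |f (p + t * h) - ((1 - t) * (1 - 2 * t) * f p + 4 * t * (1 - t) * f (p + h / 2) +
        t * (2 * t - 1) * f (p + h)) - κ * (h ^ 3 * (t * (t - 1 / 2) * (t - 1)))| ≤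
        4 * K * h ^ 4 := by
  obtain ⟨f₁, f₂, f₃, f₄, H⟩ := hf
  have hp : p ∈ Icc p (p + h) := ⟨le_rfl, by linarith⟩
  have hK3 : |f₃ p| ≤ K := (H p hp).2.2.2.2.1
  have hK : 0 ≤ K := (abs_nonneg _).trans hK3
  have R := abs_sub_taylor_le H
  have R' : ∀ t ∈ Icc (0 : ℝ) 1, |f (p + t * h) - (f p + f₁ p * (t * h) + f₂ p / 2 * (t * h) ^ 2 +
      f₃ p / 6 * (t * h) ^ 3)| ≤ K * h ^ 4 := by
    intro t ht
    have := R (p + t * h) ⟨by nlinarith [ht.1], by nlinarith [ht.2]⟩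
    rw [add_sub_cancel_left] at this
    refine this.trans ?_
    have : 0 ≤ t * h := mul_nonneg ht.1 hh.le
    have : t * h ≤ h := by nlinarith [ht.2]
    gcongr
  -- Interpolation reproduces quadratics, and sends the cubic Taylor term to an error equal to its
  -- coefficient times the nodal cubic.
  refine ⟨f₃ p / 6, ?_, fun t ht => ?_⟩
  · rw [abs_div, abs_of_pos (by norm_num : (0 : ℝ) < 6)]
    linarith [abs_nonneg (f₃ p)]
  -- The Taylor remainder enters once at `t` and, through the nodal values, with norm `3`; hence the
  -- factor `4`.
  have A0 := R' 0 (by simp)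
  have A1 := R' (1 / 2) (by norm_num)
  have A2 := R' 1 (by simp)
  have A := R' t ht
  have B := abs_three_point_le ht A0 A1 A2
  have B2 := (abs_sub _ _).trans (add_le_add A B)
  have : p + 1 / 2 * h = p + h / 2 := by ring
  rw [this, one_mul, zero_mul, add_zero] at B2
  refine le_trans (le_of_eq ?_) (B2.trans (by linarith))
  congr 1
  ring

/-! ### Superconvergence under monotone weights. -/

/-- The cubic is odd about the cell midpoint; its antiderivative used here vanishes at both ends. -/
theorem integral_cell_cubic (p h : ℝ) :
    ∫ x in p..p + h, (x - p) * (x - p - h / 2) * (x - p - h) = 0 := by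
  have : ∀ x ∈ uIcc p (p + h), HasDerivAt (fun x : ℝ => (x - p) ^ 2 * (x - p - h) ^ 2 / 4)
      ((x - p) * (x - p - h / 2) * (x - p - h)) x := by
    intro x _
    have h1 : HasDerivAt (fun z : ℝ => z - p) 1 x := (hasDerivAt_id x).sub_const p
    refine (((h1.pow 2).mul ((h1.sub_const h).pow 2)).div_const 4).congr_deriv ?_
    norm_num
    ring
  rw [intervalIntegral.integral_eq_sub_of_hasDerivAt this (by
    apply Continuous.intervalIntegrable; fun_prop)]
  ring

theorem lineInterp_cell {a b : ℝ} {M n : ℕ} (h : 0 < meshSize a b M) (hn : n < M) {t : ℝ}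
    (ht : t ∈ Icc (0 : ℝ) 1) (f : ℝ → ℝ) :
    lineInterp a b M f (a + n * meshSize a b M + t * meshSize a b M) =
      (1 - t) * (1 - 2 * t) * f (a + n * meshSize a b M) +
        4 * t * (1 - t) * f (a + n * meshSize a b M + meshSize a b M / 2) +
        t * (2 * t - 1) * f (a + n * meshSize a b M + meshSize a b M) := by
  have := sum_quadBasis_mul h hn ht (fun l => f (halfNode a b M l))
  rw [lineInterp, show a + n * meshSize a b M + t * meshSize a b M = a + (n + t) * meshSize a b M by
    ring, this]
  simp only [halfNode]
  push_cast
  have e1 : a + 2 * (n : ℝ) / 2 * meshSize a b M = a + n * meshSize a b M := by ring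
  have e2 : a + (2 * (n : ℝ) + 1) / 2 * meshSize a b M =
      a + n * meshSize a b M + meshSize a b M / 2 := by ring
  have e3 : a + (2 * (n : ℝ) + 2) / 2 * meshSize a b M =
      a + n * meshSize a b M + meshSize a b M := by ring
  rw [e1, e2, e3]

/-- Freezing the weight at the left end of the cell annihilates the cubic part of the error. The
cubic then only meets `v x - v p`, which monotonicity bounds by the increment of `v` over the cell.
-/
theorem abs_integral_cell_le {a b K W : ℝ} (hab : a < b) {M n : ℕ} (hM : 1 ≤ M) (hn : n < M)
    {f v : ℝ → ℝ} (hf : HasFourDerivsBound f a b K) (hv : MonotoneOn v (Icc a b))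
    (hW : ∀ x ∈ Icc a b, |v x| ≤ W) :
    |∫ x in (a + n * meshSize a b M)..(a + n * meshSize a b M + meshSize a b M),
        v x * (f x - lineInterp a b M f x)| ≤
      4 * K * W * meshSize a b M ^ 5 + K * meshSize a b M ^ 4 *
        (v (a + n * meshSize a b M + meshSize a b M) - v (a + n * meshSize a b M)) := by
  have h := meshSize_pos hab hM
  have hM' := natCast_mul_meshSize (a := a) (b := b) hM
  have hIc := continuous_lineInterp h f
  have hcell := fun t (ht : t ∈ Icc (0 : ℝ) 1) => lineInterp_cell h hn ht f
  have hn' : (n : ℝ) + 1 ≤ M := by exact_mod_cast hn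
  have hn0 : (0 : ℝ) ≤ n := by positivity
  generalize meshSize a b M = H at *
  have hs : Icc (a + n * H) (a + n * H + H) ⊆ Icc a b :=
    Icc_subset_Icc (by nlinarith) (by nlinarith)
  generalize a + n * H = p at *
  have hu : uIcc p (p + H) = Icc p (p + H) := uIcc_of_le (by linarith)
  obtain ⟨κ, hκ, hE⟩ := exists_abs_interpError_sub_le h (hf.mono hs)
  have hp : p ∈ Icc p (p + H) := ⟨le_rfl, by linarith⟩
  have hq : p + H ∈ Icc p (p + H) := ⟨by linarith, le_rfl⟩
  have hK : 0 ≤ K := (abs_nonneg _).trans hκ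
  have hcont : ContinuousOn (fun x => f x - lineInterp a b M f x) (uIcc p (p + H)) := by
    rw [hu]; exact (hf.continuousOn.mono hs).sub hIc.continuousOn
  have hint : IntervalIntegrable (fun x => v x * (f x - lineInterp a b M f x)) volume p (p + H) :=
    (MonotoneOn.intervalIntegrable (by rw [hu]; exact hv.mono hs)).mul_continuousOn hcont
  have hsub : ∫ x in p..p + H, v x * (f x - lineInterp a b M f x) =
      ∫ x in p..p + H, (v x * (f x - lineInterp a b M f x) -
        v p * κ * ((x - p) * (x - p - H / 2) * (x - p - H))) := by
    rw [intervalIntegral.integral_sub hint (by apply Continuous.intervalIntegrable; fun_prop),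
      intervalIntegral.integral_const_mul, integral_cell_cubic, mul_zero, sub_zero]
  rw [hsub, ← Real.norm_eq_abs]
  refine (intervalIntegral.norm_integral_le_of_norm_le_const (C := 4 * K * W * H ^ 4 + K * H ^ 3 *
    (v (p + H) - v p)) ?_).trans (le_of_eq ?_)
  · intro x hx
    rw [uIoc_of_le (by linarith)] at hx
    have hx : x ∈ Icc p (p + H) := ⟨hx.1.le, hx.2⟩
    obtain ⟨t, rfl⟩ : ∃ t, x = p + t * H := ⟨(x - p) / H, by field_simp; ring⟩
    have ht : t ∈ Icc (0 : ℝ) 1 := by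
      obtain ⟨h1, h2⟩ := hx
      constructor <;> by_contra! hc <;> nlinarith
    have e := hE t ht
    rw [← hcell t ht] at e
    have hv1 : v p ≤ v (p + t * H) := hv (hs hp) (hs hx) hx.1
    have hv2 : v (p + t * H) ≤ v (p + H) := hv (hs hx) (hs hq) hx.2
    have hP : |H ^ 3 * (t * (t - 1 / 2) * (t - 1))| ≤ H ^ 3 := by
      rw [abs_mul, abs_of_nonneg (by positivity : 0 ≤ H ^ 3)]
      have : |t * (t - 1 / 2) * (t - 1)| ≤ 1 := by
        rw [abs_mul, abs_mul]
        have h1 : |t| ≤ 1 := abs_le.2 ⟨by linarith [ht.1], ht.2⟩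
        have h2 : |t - 1 / 2| ≤ 1 := abs_le.2 ⟨by linarith [ht.1], by linarith [ht.2]⟩
        have h3 : |t - 1| ≤ 1 := abs_le.2 ⟨by linarith [ht.1], by linarith [ht.2]⟩
        exact mul_le_one₀ (mul_le_one₀ h1 (abs_nonneg _) h2) (abs_nonneg _) h3
      exact mul_le_of_le_one_right (by positivity) this
    have key : v (p + t * H) * (f (p + t * H) - lineInterp a b M f (p + t * H)) -
        v p * κ * ((p + t * H - p) * (p + t * H - p - H / 2) * (p + t * H - p - H)) =
        v (p + t * H) * (f (p + t * H) - lineInterp a b M f (p + t * H) -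
          κ * (H ^ 3 * (t * (t - 1 / 2) * (t - 1)))) +
        κ * (H ^ 3 * (t * (t - 1 / 2) * (t - 1))) * (v (p + t * H) - v p) := by ring
    rw [key, Real.norm_eq_abs]
    refine (abs_add_le _ _).trans (add_le_add ?_ ?_)
    · rw [abs_mul]
      have := mul_le_mul (hW _ (hs hx)) e (abs_nonneg _) ((abs_nonneg _).trans (hW _ (hs hx)))
      exact this.trans (le_of_eq (by ring))
    · rw [abs_mul, abs_mul, abs_of_nonneg (by linarith : 0 ≤ v (p + t * H) - v p)]
      have : |κ| * |H ^ 3 * (t * (t - 1 / 2) * (t - 1))| ≤ K * H ^ 3 :=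
        mul_le_mul hκ hP (abs_nonneg _) hK
      exact mul_le_mul this (by linarith) (by linarith) (by positivity)
  · rw [add_sub_cancel_left, abs_of_pos h]
    ring

/-- Superconvergence of piecewise quadratic interpolation under a monotone weight. -/
theorem abs_integral_monotoneOn_mul_interpError_le {a b K W : ℝ} (hab : a < b) {M : ℕ}
    (hM : 1 ≤ M) {f v : ℝ → ℝ} (hf : HasFourDerivsBound f a b K) (hv : MonotoneOn v (Icc a b))
    (hW : ∀ x ∈ Icc a b, |v x| ≤ W) :
    |∫ x in a..b, v x * (f x - lineInterp a b M f x)| ≤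
      (4 * (b - a) + 2) * K * W * meshSize a b M ^ 4 := by
  have h := meshSize_pos hab hM
  have hM' := natCast_mul_meshSize (a := a) (b := b) hM
  have hK : 0 ≤ K := by
    obtain ⟨f₁, f₂, f₃, f₄, H⟩ := hf
    exact (abs_nonneg _).trans (H a ⟨le_rfl, hab.le⟩).2.2.2.2.1
  have hcell := fun n (hn : n < M) => abs_integral_cell_le hab hM hn hf hv hW
  have hcont : ContinuousOn (fun x => f x - lineInterp a b M f x) (Icc a b) :=
    hf.continuousOn.sub (continuous_lineInterp h f).continuousOn
  generalize meshSize a b M = H at *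
  have e : ∀ n : ℕ, a + n * H + H = a + (n + 1 : ℕ) * H := fun n => by push_cast; ring
  simp only [e] at hcell
  have hsum := intervalIntegral.sum_integral_adjacent_intervals (μ := volume)
    (f := fun x => v x * (f x - lineInterp a b M f x)) (a := fun n : ℕ => a + n * H) (n := M) (by
      intro n hn
      have hn' : (n : ℝ) + 1 ≤ M := by exact_mod_cast hn
      have hn0 : (0 : ℝ) ≤ n := by positivity
      have hs : uIcc (a + n * H) (a + (n + 1 : ℕ) * H) ⊆ Icc a b := by
        push_cast
        rw [uIcc_of_le (by nlinarith)]
        exact Icc_subset_Icc (by nlinarith) (by nlinarith)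
      exact (MonotoneOn.intervalIntegrable (hv.mono hs)).mul_continuousOn (hcont.mono hs))
  have eb : a + M * H = b := by linarith
  simp only [Nat.cast_zero, zero_mul, add_zero, eb] at hsum
  rw [← hsum]
  refine (Finset.abs_sum_le_sum_abs _ _).trans ((Finset.sum_le_sum fun n hn =>
    hcell n (Finset.mem_range.1 hn)).trans ?_)
  -- The increments telescope to `v b - v a ≤ 2 W`, and `M` cells of width `H` make up `b - a`.
  rw [Finset.sum_add_distrib, Finset.sum_const, Finset.card_range, ← Finset.mul_sum,
    Finset.sum_range_sub (fun n : ℕ => v (a + n * H))]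
  simp only [Nat.cast_zero, zero_mul, add_zero, eb, nsmul_eq_mul]
  have h1 : v b - v a ≤ 2 * W := by
    have := (abs_le.1 (hW a ⟨le_rfl, hab.le⟩)).1
    have := (abs_le.1 (hW b ⟨hab.le, le_rfl⟩)).2
    linarith
  have h2 : K * H ^ 4 * (v b - v a) ≤ K * H ^ 4 * (2 * W) := by gcongr
  have h3 : (M : ℝ) * (4 * K * W * H ^ 5) = 4 * (M * H) * K * W * H ^ 4 := by ring
  rw [h3, hM']
  linarith

/-! ### The kernel on a line. -/

/-- The additive kernel in one variable: it is centred at `x₀`, at distance `|A|` from the line. -/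
noncomputable def lineKernel (γ A x₀ x : ℝ) : ℝ := (|Real.sqrt ((x₀ - x) ^ 2 + A ^ 2)| ^ γ)⁻¹

theorem lineKernel_nonneg (γ A x₀ x : ℝ) : 0 ≤ lineKernel γ A x₀ x := by
  unfold lineKernel; positivity

/-- `A ≠ 0` is essential: for `A = 0` and `γ > 0` the kernel takes the junk value `0` at its
singularity, which destroys monotonicity. -/
theorem lineKernel_le_of_sq_le {γ A x₀ x y : ℝ} (hγ : 0 ≤ γ) (hA : A ≠ 0)
    (hxy : (x₀ - x) ^ 2 ≤ (x₀ - y) ^ 2) : lineKernel γ A x₀ y ≤ lineKernel γ A x₀ x := by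
  unfold lineKernel
  have : 0 < (x₀ - x) ^ 2 + A ^ 2 := by positivity
  rw [abs_of_nonneg (Real.sqrt_nonneg _), abs_of_nonneg (Real.sqrt_nonneg _)]
  have : 0 < Real.sqrt ((x₀ - x) ^ 2 + A ^ 2) := Real.sqrt_pos.2 this
  gcongr

theorem lineKernel_le {γ A x₀ x : ℝ} (hγ : 0 ≤ γ) (hA : A ≠ 0) :
    lineKernel γ A x₀ x ≤ |A| ^ (-γ) := by
  refine (lineKernel_le_of_sq_le hγ hA (x := x₀) (by rw [sub_self]; nlinarith [sq_nonneg (x₀ - x)])).trans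
    (le_of_eq ?_)
  rw [lineKernel, sub_self, zero_pow two_ne_zero, zero_add, Real.sqrt_sq_eq_abs, abs_abs,
    Real.rpow_neg (abs_nonneg _)]

/-- The kernel splits into two monotone parts, so that the bound for monotone weights applies. -/
theorem abs_integral_lineKernel_mul_interpError_le {a b K γ A x₀ : ℝ} (hγ : 0 ≤ γ) (hA : A ≠ 0)
    (hab : a < b) {M : ℕ} (hM : 1 ≤ M) {f : ℝ → ℝ} (hf : HasFourDerivsBound f a b K) :
    |∫ x in a..b, lineKernel γ A x₀ x * (f x - lineInterp a b M f x)| ≤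
      3 * (4 * (b - a) + 2) * K * meshSize a b M ^ 4 * |A| ^ (-γ) := by
  have hcont : ContinuousOn (fun x => f x - lineInterp a b M f x) (uIcc a b) := by
    rw [uIcc_of_le hab.le]
    exact hf.continuousOn.sub (continuous_lineInterp (meshSize_pos hab hM) f).continuousOn
  have hk : ∀ x, |lineKernel γ A x₀ x| ≤ |A| ^ (-γ) := fun x => by
    rw [abs_of_nonneg (lineKernel_nonneg _ _ _ _)]; exact lineKernel_le hγ hA
  have m1 : MonotoneOn (fun x => lineKernel γ A x₀ (min x x₀)) (Icc a b) := by
    intro x _ y _ hxy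
    refine lineKernel_le_of_sq_le hγ hA ?_
    have h1 := min_le_right y x₀
    have h2 : min x x₀ ≤ min y x₀ := min_le_min_right _ hxy
    nlinarith
  have m2 : MonotoneOn (fun x => -lineKernel γ A x₀ (max x x₀)) (Icc a b) := by
    intro x _ y _ hxy
    refine neg_le_neg (lineKernel_le_of_sq_le hγ hA ?_)
    have h1 := le_max_right x x₀
    have h2 : max x x₀ ≤ max y x₀ := max_le_max_right _ hxy
    nlinarith
  have m3 : MonotoneOn (fun _ : ℝ => lineKernel γ A x₀ x₀) (Icc a b) := monotoneOn_const
  have B1 := abs_integral_monotoneOn_mul_interpError_le hab hM hf m1 (fun x _ => hk _)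
  have B2 := abs_integral_monotoneOn_mul_interpError_le hab hM hf m2
    (fun x _ => (abs_neg _).trans_le (hk _))
  have B3 := abs_integral_monotoneOn_mul_interpError_le hab hM hf m3 (fun x _ => hk _)
  rw [← uIcc_of_le hab.le] at m1 m2 m3
  have i1 := (m1.intervalIntegrable (μ := volume)).mul_continuousOn hcont
  have i2 := (m2.intervalIntegrable (μ := volume)).mul_continuousOn hcont
  have i3 := (m3.intervalIntegrable (μ := volume)).mul_continuousOn hcont
  -- One of `min x x₀`, `max x x₀` is `x` and the other is `x₀`; the constant weight removes the
  -- surplus. Three weights give the factor `3`.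
  have e : ∀ x, lineKernel γ A x₀ x * (f x - lineInterp a b M f x) =
      lineKernel γ A x₀ (min x x₀) * (f x - lineInterp a b M f x) -
      -lineKernel γ A x₀ (max x x₀) * (f x - lineInterp a b M f x) -
      lineKernel γ A x₀ x₀ * (f x - lineInterp a b M f x) := by
    intro x
    rcases le_total x x₀ with h | h
    · rw [min_eq_left h, max_eq_right h]; ring
    · rw [min_eq_right h, max_eq_left h]; ring
  simp_rw [e]
  rw [intervalIntegral.integral_sub (i1.sub i2) i3, intervalIntegral.integral_sub i1 i2]
  refine (abs_sub _ _).trans ((add_le_add ((abs_sub _ _).trans (add_le_add B1 B2)) B3).trans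
    (le_of_eq ?_))
  ring

/-! ### Integration across the lines. -/

theorem intervalIntegrable_abs_rpow_neg {γ : ℝ} (hγ : γ < 1) (p q : ℝ) :
    IntervalIntegrable (fun s : ℝ => |s| ^ (-γ)) volume p q := by
  have h0 : ∀ r : ℝ, 0 ≤ r → IntervalIntegrable (fun s : ℝ => |s| ^ (-γ)) volume 0 r := by
    intro r hr
    refine (intervalIntegral.intervalIntegrable_rpow' (by linarith : -1 < -γ)).congr_uIoo ?_
    intro s hs
    rw [uIoo_of_le hr] at hs
    simp only [abs_of_pos hs.1]
  have h1 : ∀ r : ℝ, IntervalIntegrable (fun s : ℝ => |s| ^ (-γ)) volume 0 r := by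
    intro r
    rcases le_total 0 r with hr | hr
    · exact h0 r hr
    · rw [IntervalIntegrable.iff_comp_neg]
      simpa using h0 (-r) (by linarith)
  exact (h1 p).symm.trans (h1 q)

theorem intervalIntegrable_abs_sub_rpow_neg {γ : ℝ} (hγ : γ < 1) (y₀ p q : ℝ) :
    IntervalIntegrable (fun y : ℝ => |y₀ - y| ^ (-γ)) volume p q := by
  have := (intervalIntegrable_abs_rpow_neg hγ (y₀ - p) (y₀ - q)).comp_sub_left y₀
  simpa using this

/-- After translation by `y₀` the interval lies in `[c - d, d - c]`, so the bound does not depend on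
the mesh point. -/
theorem integral_abs_sub_rpow_neg_le {γ c d y₀ : ℝ} (hγ : γ < 1) (hcd : c ≤ d)
    (hy : y₀ ∈ Icc c d) :
    ∫ y in c..d, |y₀ - y| ^ (-γ) ≤ ∫ s in (c - d)..(d - c), |s| ^ (-γ) := by
  rw [intervalIntegral.integral_comp_sub_left (fun s => |s| ^ (-γ)) y₀]
  exact intervalIntegral.integral_mono_interval (by linarith [hy.1]) (by linarith)
    (by linarith [hy.2]) (ae_of_all _ fun s => by positivity) (intervalIntegrable_abs_rpow_neg hγ _ _)

theorem integral_abs_rpow_neg_nonneg (γ : ℝ) {T : ℝ} (hT : 0 ≤ T) :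
    0 ≤ ∫ s in (-T)..T, |s| ^ (-γ) :=
  intervalIntegral.integral_nonneg (by linarith) fun s _ => by positivity

/-- The bound for a double integral whose inner integral is controlled off one line. -/
theorem abs_integral_integral_le {γ c d y₀ B : ℝ} (hγ : γ < 1) (hcd : c ≤ d) (hB : 0 ≤ B)
    (hy : y₀ ∈ Icc c d) {F : ℝ → ℝ} (hF : ∀ y ∈ Icc c d, y₀ - y ≠ 0 → |F y| ≤ B * |y₀ - y| ^ (-γ)) :
    |∫ y in c..d, F y| ≤ B * ∫ s in (c - d)..(d - c), |s| ^ (-γ) := by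
  refine le_trans ?_ (mul_le_mul_of_nonneg_left (integral_abs_sub_rpow_neg_le hγ hcd hy) hB)
  rw [← intervalIntegral.integral_const_mul, ← Real.norm_eq_abs]
  refine intervalIntegral.norm_integral_le_of_norm_le hcd ?_
    ((intervalIntegrable_abs_sub_rpow_neg hγ y₀ c d).const_mul B)
  filter_upwards [Measure.ae_ne volume y₀] with y hne hyc
  exact hF y ⟨hyc.1.le, hyc.2⟩ (sub_ne_zero.2 hne.symm)

/-- Off the null line `y = y₀` the kernel is dominated by `|y₀ - y|^(-γ)`, a function of `y` alone.
-/
theorem integrableOn_kernel {γ c d y₀ : ℝ} (hγ0 : 0 < γ) (hγ : γ < 1) (hcd : c ≤ d) (a b x₀ : ℝ) :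
    IntegrableOn (fun p : ℝ × ℝ => lineKernel γ (y₀ - p.2) x₀ p.1) (Icc a b ×ˢ Icc c d) := by
  have h1 : Integrable (fun y : ℝ => |y₀ - y| ^ (-γ)) (volume.restrict (Icc c d)) :=
    (intervalIntegrable_iff_integrableOn_Icc_of_le hcd).1
      (intervalIntegrable_abs_sub_rpow_neg hγ y₀ c d)
  have h2 : Integrable (fun _ : ℝ => (1 : ℝ)) (volume.restrict (Icc a b)) := integrable_const _
  have h3 := h2.mul_prod h1
  rw [Measure.prod_restrict, ← Measure.volume_eq_prod] at h3
  refine Integrable.mono' h3 ?_ ?_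
  · unfold lineKernel
    exact Measurable.aestronglyMeasurable (by fun_prop)
  · refine ae_restrict_of_ae ?_
    have hne : ∀ᵐ p : ℝ × ℝ, p.2 ≠ y₀ := by
      rw [Measure.volume_eq_prod]
      exact Measure.quasiMeasurePreserving_snd.ae (Measure.ae_ne volume y₀)
    filter_upwards [hne] with p hp
    rw [Real.norm_eq_abs, abs_of_nonneg (lineKernel_nonneg _ _ _ _), one_mul]
    exact lineKernel_le hγ0.le (sub_ne_zero.2 hp.symm)

/-! ### Derivatives of slices. -/

theorem ContDiffOn.fderivWithin_apply {s : Set (ℝ × ℝ)} (hs : UniqueDiffOn ℝ s) {n : ℕ}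
    {u : ℝ × ℝ → ℝ} (hu : ContDiffOn ℝ (n + 1 : ℕ) u s) (v : ℝ × ℝ) :
    ContDiffOn ℝ n (fun p => fderivWithin ℝ u s p v) s :=
  (hu.fderivWithin hs (by norm_cast)).clm_apply contDiffOn_const

theorem ContDiffOn.hasDerivWithinAt_slice {a b c d : ℝ} {n : ℕ} {u : ℝ × ℝ → ℝ}
    (hu : ContDiffOn ℝ (n + 1 : ℕ) u (Icc a b ×ˢ Icc c d)) {x y : ℝ} (hx : x ∈ Icc a b)
    (hy : y ∈ Icc c d) :
    HasDerivWithinAt (fun s => u (s, y)) (fderivWithin ℝ u (Icc a b ×ˢ Icc c d) (x, y) (1, 0))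
      (Icc a b) x := by
  have hd : DifferentiableOn ℝ u (Icc a b ×ˢ Icc c d) := hu.differentiableOn (by norm_cast)
  have h := (hd (x, y) ⟨hx, hy⟩).hasFDerivWithinAt
  have hm : MapsTo (fun s : ℝ => (s, y)) (Icc a b) (Icc a b ×ˢ Icc c d) := fun s hs => ⟨hs, hy⟩
  exact h.comp_hasDerivWithinAt x ((hasDerivWithinAt_id x _).prodMk (hasDerivWithinAt_const x _ y))
    hm

/-- The slices of a `C⁴` function on a rectangle have uniformly bounded derivatives. -/
theorem ContDiffOn.exists_hasFourDerivsBound {a b c d : ℝ} (hab : a < b) (hcd : c < d)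
    {u : ℝ × ℝ → ℝ} (hu : ContDiffOn ℝ (4 : ℕ) u (Icc a b ×ˢ Icc c d)) :
    ∃ K, 0 ≤ K ∧ ∀ y ∈ Icc c d, HasFourDerivsBound (fun s => u (s, y)) a b K := by
  have hs : UniqueDiffOn ℝ (Icc a b ×ˢ Icc c d) := (uniqueDiffOn_Icc hab).prod (uniqueDiffOn_Icc hcd)
  have hc : IsCompact (Icc a b ×ˢ Icc c d) := isCompact_Icc.prod isCompact_Icc
  have h1 := ContDiffOn.fderivWithin_apply hs (n := 3) hu (1, 0)
  have h2 := ContDiffOn.fderivWithin_apply hs (n := 2) h1 (1, 0)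
  have h3 := ContDiffOn.fderivWithin_apply hs (n := 1) h2 (1, 0)
  have h4 := ContDiffOn.fderivWithin_apply hs (n := 0) h3 (1, 0)
  obtain ⟨K3, hK3⟩ := hc.exists_bound_of_continuousOn h3.continuousOn
  obtain ⟨K4, hK4⟩ := hc.exists_bound_of_continuousOn h4.continuousOn
  refine ⟨max 0 (max K3 K4), le_max_left _ _, fun y hy => ⟨_, _, _, _, fun x hx =>
    ⟨hu.hasDerivWithinAt_slice (n := 3) hx hy, h1.hasDerivWithinAt_slice (n := 2) hx hy,
    h2.hasDerivWithinAt_slice (n := 1) hx hy, h3.hasDerivWithinAt_slice (n := 0) hx hy,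
    (hK3 _ ⟨hx, hy⟩).trans ((le_max_left _ _).trans (le_max_right _ _)),
    (hK4 _ ⟨hx, hy⟩).trans ((le_max_right _ _).trans (le_max_right _ _))⟩⟩⟩

/-! ### From lines to the rectangle. -/

theorem quadInterp_eq_lineInterp (a b c d : ℝ) (Mx My : ℕ) (u : ℝ × ℝ → ℝ) (x y : ℝ) :
    quadInterp a b c d Mx My u x y =
      lineInterp a b Mx (fun s => lineInterp c d My (fun t => u (s, t)) y) x := rfl

theorem continuousOn_lineInterp_slice {a b c d : ℝ} (hab : a < b) {M : ℕ} (hM : 1 ≤ M)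
    {g : ℝ × ℝ → ℝ} (hg : ContinuousOn g (Icc a b ×ˢ Icc c d)) :
    ContinuousOn (fun p : ℝ × ℝ => lineInterp a b M (fun s => g (s, p.2)) p.1)
      (Icc a b ×ˢ Icc c d) := by
  refine continuousOn_finsetSum _ fun l hl => ContinuousOn.mul
    ((continuous_quadBasis (meshSize_pos hab hM) l).comp continuous_fst).continuousOn ?_
  have hl := halfNode_mem_Icc hab hM (k := l) (by have := Finset.mem_range.1 hl; omega)
  exact hg.comp (by fun_prop) fun p hp => ⟨hl, hp.2⟩

theorem continuousOn_lineInterp_slice_snd {a b c d : ℝ} (hcd : c < d) {M : ℕ} (hM : 1 ≤ M)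
    {g : ℝ × ℝ → ℝ} (hg : ContinuousOn g (Icc a b ×ˢ Icc c d)) :
    ContinuousOn (fun p : ℝ × ℝ => lineInterp c d M (fun t => g (p.1, t)) p.2)
      (Icc a b ×ˢ Icc c d) := by
  refine continuousOn_finsetSum _ fun l hl => ContinuousOn.mul
    ((continuous_quadBasis (meshSize_pos hcd hM) l).comp continuous_snd).continuousOn ?_
  have hl := halfNode_mem_Icc hcd hM (k := l) (by have := Finset.mem_range.1 hl; omega)
  exact hg.comp (by fun_prop) fun p hp => ⟨hp.1, hl⟩

theorem IntegrableOn.rectangle_swap {a b c d : ℝ} (hab : a ≤ b) (hcd : c ≤ d) {G : ℝ × ℝ → ℝ}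
    (hG : IntegrableOn G (Icc a b ×ˢ Icc c d)) :
    ∫ y in c..d, ∫ x in a..b, G (x, y) = ∫ x in a..b, ∫ y in c..d, G (x, y) := by
  have h : Integrable G ((volume.restrict (Ioc a b)).prod (volume.restrict (Ioc c d))) := by
    rw [Measure.prod_restrict, ← Measure.volume_eq_prod]
    exact hG.mono_set (prod_mono Ioc_subset_Icc_self Ioc_subset_Icc_self)
  simp only [intervalIntegral.integral_of_le hab, intervalIntegral.integral_of_le hcd]
  exact (integral_integral_swap (f := fun x y => G (x, y)) h).symm

theorem IntegrableOn.rectangle_add {a b c d : ℝ} (hab : a ≤ b) (hcd : c ≤ d) {F G : ℝ × ℝ → ℝ}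
    (hF : IntegrableOn F (Icc a b ×ˢ Icc c d)) (hG : IntegrableOn G (Icc a b ×ˢ Icc c d)) :
    ∫ y in c..d, ∫ x in a..b, (F (x, y) + G (x, y)) =
      (∫ y in c..d, ∫ x in a..b, F (x, y)) + ∫ y in c..d, ∫ x in a..b, G (x, y) := by
  have key : ∀ {H : ℝ × ℝ → ℝ}, IntegrableOn H (Icc a b ×ˢ Icc c d) →
      Integrable H ((volume.restrict (Ioc a b)).prod (volume.restrict (Ioc c d))) := by
    intro H hH
    rw [Measure.prod_restrict, ← Measure.volume_eq_prod]
    exact hH.mono_set (prod_mono Ioc_subset_Icc_self Ioc_subset_Icc_self)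
  simp only [intervalIntegral.integral_of_le hab, intervalIntegral.integral_of_le hcd]
  have e := integral_prod_symm _ ((key hF).add (key hG))
  rw [integral_add' (key hF) (key hG), integral_prod_symm _ (key hF), integral_prod_symm _ (key hG)]
    at e
  exact e.symm

/-- For an interior mesh point `0 < η ≤ b - a`. This allows `η^(-γ)` to be inserted into a bound of
order `h^4`. -/
theorem one_le_mul_endDist_rpow {a b γ : ℝ} (hab : a < b) (hγ : 0 ≤ γ) {M i : ℕ} (hM : 1 ≤ M)
    (hi : i ∈ Finset.Icc 1 (2 * M - 1)) :
    1 ≤ (b - a) ^ γ * endDist a b M i ^ (-γ) := by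
  have h := meshSize_pos hab hM
  have hM' := natCast_mul_meshSize (a := a) (b := b) hM
  rw [Finset.mem_Icc] at hi
  have h1 : (1 : ℝ) ≤ i := by exact_mod_cast hi.1
  have h2 : (i : ℝ) + 1 ≤ 2 * M := by
    have : i + 1 ≤ 2 * M := by omega
    exact_mod_cast this
  have h0 : 0 < endDist a b M i := by
    simp only [endDist, halfNode, Int.cast_natCast]
    exact lt_min (by nlinarith) (by nlinarith)
  have hle : endDist a b M i ≤ b - a := by
    have := (halfNode_mem_Icc hab hM (k := i) (by omega)).2
    exact (min_le_left _ _).trans (by linarith)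
  rw [Real.rpow_neg h0.le, ← div_eq_mul_inv, one_le_div (Real.rpow_pos_of_pos h0 _)]
  exact Real.rpow_le_rpow h0.le hle hγ

theorem lemma3p12 (a b c d γ : ℝ) (hab : a < b) (hcd : c < d) (hγ0 : 0 < γ) (hγ1 : γ < 1)
    (u : ℝ × ℝ → ℝ) (hu : ContDiffOn ℝ 6 u (Set.Icc a b ×ˢ Set.Icc c d)) :
    ∃ C : ℝ, ∀ Mx My : ℕ, 1 ≤ Mx → 1 ≤ My →
      ∀ i ∈ Finset.Icc 1 (2 * Mx - 1), ∀ j ∈ Finset.Icc 1 (2 * My - 1),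
        MeasureTheory.IntegrableOn
          (fun p : ℝ × ℝ => additiveErrorIntegrand a b c d γ Mx My u i j p.1 p.2)
          (Set.Icc a b ×ˢ Set.Icc c d) ∧
        |∫ y in c..d, ∫ x in a..b, additiveErrorIntegrand a b c d γ Mx My u i j x y| ≤
          C * (meshSize a b Mx ^ 4 * endDist a b Mx i ^ (-γ) +
              meshSize c d My ^ 4 * endDist c d My j ^ (-γ)) +
            C * (meshSize a b Mx ^ (5 - γ) + meshSize c d My ^ (5 - γ)) := by
  have hu4 : ContDiffOn ℝ (4 : ℕ) u (Icc a b ×ˢ Icc c d) := hu.of_le (by norm_num)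
  obtain ⟨K₁, hK₁, D₁⟩ := hu4.exists_hasFourDerivsBound hab hcd
  have hsw : ContDiffOn ℝ (4 : ℕ) (u ∘ Prod.swap) (Icc c d ×ˢ Icc a b) :=
    hu4.comp (contDiff_snd.prodMk contDiff_fst).contDiffOn fun p hp => ⟨hp.2, hp.1⟩
  obtain ⟨K₂, hK₂, D₂⟩ := hsw.exists_hasFourDerivsBound hcd hab
  set J₁ := ∫ s in (c - d)..(d - c), |s| ^ (-γ) with hJ₁
  set J₂ := ∫ s in (a - b)..(b - a), |s| ^ (-γ) with hJ₂
  have hJ₁0 : 0 ≤ J₁ := by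
    have := integral_abs_rpow_neg_nonneg γ (sub_nonneg.2 hcd.le)
    rwa [neg_sub] at this
  have hJ₂0 : 0 ≤ J₂ := by
    have := integral_abs_rpow_neg_nonneg γ (sub_nonneg.2 hab.le)
    rwa [neg_sub] at this
  have ha : 0 < b - a := sub_pos.2 hab
  have hc : 0 < d - c := sub_pos.2 hcd
  set A₁ := 3 * (4 * (b - a) + 2) * K₁ with hA₁
  -- The outer `3` is the norm bound for the interpolation in `x` applied to the error in `y`.
  set A₂ := 3 * (3 * (4 * (d - c) + 2) * K₂) with hA₂
  have hA₁0 : 0 ≤ A₁ := by positivity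
  have hA₂0 : 0 ≤ A₂ := by positivity
  refine ⟨A₁ * J₁ * (b - a) ^ γ + A₂ * J₂ * (d - c) ^ γ, fun Mx My hMx hMy i hi j hj => ?_⟩
  have hx := meshSize_pos hab hMx
  have hy := meshSize_pos hcd hMy
  have hxi : halfNode a b Mx i ∈ Icc a b :=
    halfNode_mem_Icc hab hMx (by rw [Finset.mem_Icc] at hi; omega)
  have hyj : halfNode c d My j ∈ Icc c d :=
    halfNode_mem_Icc hcd hMy (by rw [Finset.mem_Icc] at hj; omega)
  set x₀ := halfNode a b Mx i
  set y₀ := halfNode c d My j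
  set w : ℝ × ℝ → ℝ := fun p => lineKernel γ (y₀ - p.2) x₀ p.1 with hw
  set E₁ : ℝ × ℝ → ℝ := fun p => u p - lineInterp a b Mx (fun s => u (s, p.2)) p.1 with hE₁
  set G : ℝ × ℝ → ℝ := fun p => u p - lineInterp c d My (fun t => u (p.1, t)) p.2 with hG
  set E₂ : ℝ × ℝ → ℝ := fun p => lineInterp a b Mx (fun s => G (s, p.2)) p.1 with hE₂
  have hucont := hu4.continuousOn
  have hE₁c : ContinuousOn E₁ (Icc a b ×ˢ Icc c d) :=
    hucont.sub (continuousOn_lineInterp_slice hab hMx hucont)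
  have hGc : ContinuousOn G (Icc a b ×ˢ Icc c d) :=
    hucont.sub (continuousOn_lineInterp_slice_snd hcd hMy hucont)
  have hE₂c : ContinuousOn E₂ (Icc a b ×ˢ Icc c d) := continuousOn_lineInterp_slice hab hMx hGc
  have hcomp : IsCompact (Icc a b ×ˢ Icc c d) := isCompact_Icc.prod isCompact_Icc
  have hwI : IntegrableOn w (Icc a b ×ˢ Icc c d) := integrableOn_kernel hγ0 hγ1 hcd.le a b x₀
  have I₁ : IntegrableOn (fun p => w p * E₁ p) (Icc a b ×ˢ Icc c d) :=
    hwI.mul_continuousOn hE₁c hcomp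
  have I₂ : IntegrableOn (fun p => w p * E₂ p) (Icc a b ×ˢ Icc c d) :=
    hwI.mul_continuousOn hE₂c hcomp
  have hsplit : ∀ x y, additiveErrorIntegrand a b c d γ Mx My u i j x y =
      w (x, y) * E₁ (x, y) + w (x, y) * E₂ (x, y) := by
    intro x y
    rw [additiveErrorIntegrand, quadInterp_eq_lineInterp, div_eq_mul_inv, ← mul_add, mul_comm]
    congr 1
    simp only [hE₁, hE₂, hG, lineInterp, mul_sub, Finset.sum_sub_distrib]
    ring
  constructor
  · simp only [hsplit]
    exact I₁.add I₂
  simp only [hsplit]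
  rw [IntegrableOn.rectangle_add hab.le hcd.le I₁ I₂]
  have B₁ : |∫ y in c..d, ∫ x in a..b, w (x, y) * E₁ (x, y)| ≤ A₁ * meshSize a b Mx ^ 4 * J₁ :=
    abs_integral_integral_le hγ1 hcd.le (by positivity) hyj fun y hyc hne =>
      abs_integral_lineKernel_mul_interpError_le hγ0.le hne hab hMx (D₁ y hyc)
  have B₂ : |∫ y in c..d, ∫ x in a..b, w (x, y) * E₂ (x, y)| ≤ A₂ * meshSize c d My ^ 4 * J₂ := by
    -- With `x` outermost, interpolation in `x` commutes with the `y`-integral. What remains are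
    -- one-dimensional errors along the node lines `x = x_{l/2}`, all weighted by the kernel at
    -- distance `|x₀ - x|`.
    rw [IntegrableOn.rectangle_swap hab.le hcd.le I₂]
    refine abs_integral_integral_le hγ1 hab.le (by positivity) hxi fun x hxc hne => ?_
    have hwsymm : ∀ y, w (x, y) = lineKernel γ (x₀ - x) y₀ y := fun y => by
      simp only [hw, lineKernel]
      rw [add_comm]
    have hslice : ∀ l ≤ 2 * Mx,
        |∫ y in c..d, lineKernel γ (x₀ - x) y₀ y * G (halfNode a b Mx l, y)| ≤
          3 * (4 * (d - c) + 2) * K₂ * meshSize c d My ^ 4 * |x₀ - x| ^ (-γ) := fun l hl =>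
      abs_integral_lineKernel_mul_interpError_le hγ0.le hne hcd hMy
        (D₂ _ (halfNode_mem_Icc hab hMx hl))
    have hsum : ∫ y in c..d, w (x, y) * E₂ (x, y) =
        ∑ l ∈ Finset.range (2 * Mx + 1), quadBasis a b Mx l x *
          ∫ y in c..d, lineKernel γ (x₀ - x) y₀ y * G (halfNode a b Mx l, y) := by
      simp only [← intervalIntegral.integral_const_mul]
      rw [← intervalIntegral.integral_finsetSum]
      · refine intervalIntegral.integral_congr fun y _ => ?_
        simp only [hE₂, lineInterp, hwsymm, Finset.mul_sum]
        exact Finset.sum_congr rfl fun l _ => by ring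
      · intro l hl
        have hl := halfNode_mem_Icc hab hMx (k := l) (by have := Finset.mem_range.1 hl; omega)
        refine ContinuousOn.intervalIntegrable ?_
        rw [uIcc_of_le hcd.le]
        refine continuousOn_const.mul (ContinuousOn.mul (Continuous.continuousOn ?_)
          (hGc.comp (by fun_prop) fun y hy => ⟨hl, hy⟩))
        unfold lineKernel
        have hpos : ∀ y, 0 < Real.sqrt ((y₀ - y) ^ 2 + (x₀ - x) ^ 2) := fun y =>
          Real.sqrt_pos.2 (by positivity)
        refine Continuous.inv₀ (Continuous.rpow_const (by fun_prop) fun y =>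
          Or.inr hγ0.le) fun y => ?_
        exact (Real.rpow_pos_of_pos (abs_pos.2 (hpos y).ne') _).ne'
    rw [hsum]
    refine (abs_sum_quadBasis_mul_le hab hMx hxc hslice).trans (le_of_eq ?_)
    rw [hA₂]; ring
  have P₁ := one_le_mul_endDist_rpow hab hγ0.le hMx hi
  have P₂ := one_le_mul_endDist_rpow hcd hγ0.le hMy hj
  have Q₁ : 0 ≤ endDist a b Mx i ^ (-γ) := by
    have : 0 < (b - a) ^ γ := Real.rpow_pos_of_pos ha _
    nlinarith
  have Q₂ : 0 ≤ endDist c d My j ^ (-γ) := by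
    have : 0 < (d - c) ^ γ := Real.rpow_pos_of_pos hc _
    nlinarith
  have T₁ := mul_le_mul_of_nonneg_left P₁ (by positivity : 0 ≤ A₁ * meshSize a b Mx ^ 4 * J₁)
  have T₂ := mul_le_mul_of_nonneg_left P₂ (by positivity : 0 ≤ A₂ * meshSize c d My ^ 4 * J₂)
  have S₁ : 0 ≤ A₁ * J₁ * (b - a) ^ γ * (meshSize c d My ^ 4 * endDist c d My j ^ (-γ)) := by
    positivity
  have S₂ : 0 ≤ A₂ * J₂ * (d - c) ^ γ * (meshSize a b Mx ^ 4 * endDist a b Mx i ^ (-γ)) := by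
    positivity
  -- The terms `h^(5-γ)` only have to be nonnegative.
  have S₃ : 0 ≤ (A₁ * J₁ * (b - a) ^ γ + A₂ * J₂ * (d - c) ^ γ) *
      (meshSize a b Mx ^ (5 - γ) + meshSize c d My ^ (5 - γ)) := by positivity
  have := (abs_add_le (∫ y in c..d, ∫ x in a..b, w (x, y) * E₁ (x, y))
    (∫ y in c..d, ∫ x in a..b, w (x, y) * E₂ (x, y))).trans (add_le_add B₁ B₂)
  refine this.trans ?_
  nlinarith only [T₁, T₂, S₁, S₂, S₃]
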